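/- For $\nu\in(0,\infty)$ let $\mathcal T(\nu)$ be Student's t distribution on $\mathbb R$, with density $$f_\nu(t)=\frac{1}{\sqrt{\nu\pi}}\,\frac{\Gamma\left(\frac{\nu+1}{2}\right)}{\Gamma\left(\frac{\nu}{2}\right)}\left(1+\frac{t^2}{\nu}\right)^{-\frac{\nu+1}{2}},\qquad t\in\mathbb R,$$ and let $\mathcal T(\infty)$ be the standard normal distribution. Let $n\ge 2$, $c\in(0,1)$, let $X_1,\dots,X_n$ be i.i.d. with law $\mathcal T(\nu)$, $\nu\in(0,\infty]$, write $\mathbb P_\nu$ for the corresponding probability, and let $$S_n=\frac{\sum_{i=1}^n|X_i|^2}{\left(\sum_{i=1}^n|X_i|\right)^2}$$ be the modified Greenwood statistic. Let $Q_c(n)=\inf\{x\in\mathbb R:\mathbb P_2(S_n\le x)\ge c\}$ be the $c$-quantile of $S_n$ for $\nu=2$. Consider the test $MG_4$ of $\mathcal H_0:\nu\le 2$ against $\mathcal H_1:\nu>2$ that rejects $\mathcal H_0$ when $S_n\in[\frac1n,Q_c(n)]$, and let $\beta(\nu)=\mathbb P_\nu\left(\frac1n\le S_n\le Q_c(n)\right)$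 be its power function. Then $\mathcal T(\nu)$ has infinite second moment (infinite variance) for every $\nu\le2$ and finite variance for every $\nu>2$, and the test (a) has size $c$: $\sup_{0<\nu\le 2}\beta(\nu)=c$; (b) is unbiased: $\beta(\nu)\le c$ for all $\nu\in(0,2]$ and $\beta(\nu)\ge c$ for all $\nu\in(2,\infty]$; (c) has an increasing power function: $\beta(\nu_1)\le\beta(\nu_2)$ whenever $0<\nu_1\le\nu_2\le\infty$. -/

import Mathlib

open MeasureTheory ProbabilityTheory
open scoped ENNReal

noncomputable section

/-- The modified Greenwood statistic
`S_n(x) = (∑ |x_i|²) / (∑ |x_i|)²` of a sample `x = (x_1, …, x_n)`. -/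
def greenwoodStat {n : ℕ} (x : Fin n → ℝ) : ℝ :=
  (∑ i, |x i| ^ 2) / (∑ i, |x i|) ^ 2

/-- The density of Student's t distribution with `ν` degrees of freedom. -/
def studentTPDF (ν t : ℝ) : ℝ :=
  1 / √(ν * Real.pi) * (Real.Gamma ((ν + 1) / 2) / Real.Gamma (ν / 2)) *
    (1 + t ^ 2 / ν) ^ (-((ν + 1) / 2))

/-- Student's t distribution `𝒯(ν)` for `ν ∈ (0, ∞]`, where `𝒯(∞)` is the standard normal
distribution. -/
def studentT (ν : ℝ≥0∞) : Measure ℝ :=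
  if ν = ∞ then gaussianReal 0 1
  else volume.withDensity (fun t => ENNReal.ofReal (studentTPDF ν.toReal t))

/-- The joint law of an i.i.d. sample `X_1, …, X_n` from `𝒯(ν)`. -/
def studentTSample (n : ℕ) (ν : ℝ≥0∞) : Measure (Fin n → ℝ) :=
  Measure.pi (fun _ => studentT ν)

/-- The quantile of order `p` of a distribution `μ` on the line (the generalized inverse of its
distribution function). -/
def quantile (μ : Measure ℝ) (p : ℝ) : ℝ :=
  sInf {x : ℝ | p ≤ μ.real (Set.Iic x)}

/-- The critical value `Q_c(n)`: the `c`-quantile of `S_n` when the sample comes from `𝒯(2)`. -/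
def criticalValue (n : ℕ) (c : ℝ) : ℝ :=
  quantile ((studentTSample n 2).map greenwoodStat) c

/-- The set of samples for which the test `MG_4` rejects: `S_n ∈ [1/n, Q_c(n)]`. -/
def rejectionRegionMG4 (n : ℕ) (c : ℝ) : Set (Fin n → ℝ) :=
  {x | greenwoodStat x ∈ Set.Icc (1 / (n : ℝ)) (criticalValue n c)}

/-- The power function of the test `MG_4`: the probability of rejection under `𝒯(ν)`. -/
def powerMG4 (n : ℕ) (c : ℝ) (ν : ℝ≥0∞) : ℝ :=
  (studentTSample n ν).real (rejectionRegionMG4 n c)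

/-- The parameters of the null hypothesis `ν ≤ 2`. -/
def nullHyp : Set ℝ≥0∞ := {ν | 0 < ν ∧ ν ≤ 2}

/-- The parameters of the alternative hypothesis `ν > 2`. -/
def altHyp : Set ℝ≥0∞ := {ν | 2 < ν}

/-- A test with power function `β` has size `c` for the null hypothesis `H₀`: the supremum of the
probability of rejection over `H₀` equals `c`. -/
def HasSize {Θ : Type*} (β : Θ → ℝ) (H₀ : Set Θ) (c : ℝ) : Prop :=
  IsLUB (β '' H₀) c

/-- A test with power function `β` is unbiased at level `c` for `H₀` against `H₁`: it rejects with
probability at most `c` under `H₀` and at least `c` under `H₁`. -/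
def IsUnbiasedTest {Θ : Type*} (β : Θ → ℝ) (H₀ H₁ : Set Θ) (c : ℝ) : Prop :=
  (∀ θ ∈ H₀, β θ ≤ c) ∧ (∀ θ ∈ H₁, c ≤ β θ)

end

/-!
The power function of the test is monotone because the family `|X|`, `X ∼ 𝒯(ν)`, decreases in `ν`
for the star order, and the modified Greenwood statistic increases along that order.

*Star order.* Let `ν₁ ≤ ν₂` and `a > 0`. The logarithmic derivative of the density of `𝒯(ν)` is
`-(1 + κ) x / (1 + κ x²)` with `κ = 1 / ν`, so the logarithm of the ratio of the densities of
`X₁ / a` and `X₂` at `x > 0` has a derivative with the sign of an increasing affine function of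
`x²`. Hence the difference of the two densities changes sign only in the pattern `+`, `-`, `+`
(`tDensity_lt_of_crossing`). Both have the same total mass, so the difference of the distribution
functions of `|X₁| / a` and `|X₂|` changes sign at most once, from `+` to `-`. As `a` is arbitrary,
the increasing map `φ` that transports the law of `|X₂|` to that of `|X₁|` has `φ x / x`
nondecreasing (`absCDF_star_order`, `exists_star_transport`).

*Greenwood statistic.* By the inequalities of Chebyshev and Cauchy-Schwarz, applying such a `φ` to
the absolute values of a sample does not decrease the statistic
(`sum_sq_div_sq_sum_le_of_star`). Since `S_n ≥ 1 / n` almost surely, this makes the probability of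
rejection nondecreasing in `ν` (`powerMG4_mono`).

*Level.* Under `𝒯(2)` the statistic has no atoms (`pi_greenwoodStat_eq_null`), so the test rejects
with probability exactly `c` at the boundary `ν = 2` (`powerMG4_two`). Size and unbiasedness follow
by monotonicity. The second moments are compared with `∫ t⁻¹` and with powers of `1 + t²`.
-/

/-! ### Student's t distribution is a probability distribution -/

theorem lintegral_rpow_mul_exp_neg_mul_Ioi {a r : ℝ} (ha : 0 < a) (hr : 0 < r) :
    ∫⁻ s in Set.Ioi (0 : ℝ), ENNReal.ofReal (s ^ (a - 1) * Real.exp (-(r * s))) =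
      ENNReal.ofReal ((1 / r) ^ a * Real.Gamma a) := by
  have h := Real.integral_rpow_mul_exp_neg_mul_Ioi ha hr
  have hpos : 0 < (1 / r) ^ a * Real.Gamma a :=
    mul_pos (Real.rpow_pos_of_pos (by positivity) _) (Real.Gamma_pos_of_pos ha)
  rw [← h, ofReal_integral_eq_lintegral_ofReal]
  · exact Integrable.of_integral_ne_zero (by rw [h]; exact hpos.ne')
  · filter_upwards [ae_restrict_mem measurableSet_Ioi] with s hs
    exact mul_nonneg (Real.rpow_nonneg (le_of_lt hs) _) (Real.exp_pos _).le

theorem lintegral_exp_neg_mul_sq {b : ℝ} (hb : 0 < b) :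
    ∫⁻ t : ℝ, ENNReal.ofReal (Real.exp (-b * t ^ 2)) = ENNReal.ofReal √(Real.pi / b) := by
  rw [← integral_gaussian, ofReal_integral_eq_lintegral_ofReal (integrable_exp_neg_mul_sq hb)]
  exact ae_of_all _ fun t => (Real.exp_pos _).le

/-- The normalizing constant is found by writing the density as a mixture of Gaussian densities
with Gamma distributed precision, and exchanging the two integrals. -/
theorem lintegral_one_add_sq_div_rpow {ν : ℝ} (hν : 0 < ν) :
    ∫⁻ t : ℝ, ENNReal.ofReal ((1 + t ^ 2 / ν) ^ (-((ν + 1) / 2)) * Real.Gamma ((ν + 1) / 2)) =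
      ENNReal.ofReal (√(ν * Real.pi) * Real.Gamma (ν / 2)) := by
  have key : ∀ t : ℝ,
      ENNReal.ofReal ((1 + t ^ 2 / ν) ^ (-((ν + 1) / 2)) * Real.Gamma ((ν + 1) / 2)) =
      ∫⁻ s in Set.Ioi (0 : ℝ),
        ENNReal.ofReal (s ^ ((ν + 1) / 2 - 1) * Real.exp (-((1 + t ^ 2 / ν) * s))) := by
    intro t
    have hr : 0 < 1 + t ^ 2 / ν := by positivity
    rw [lintegral_rpow_mul_exp_neg_mul_Ioi (by positivity) hr, one_div,
      Real.inv_rpow hr.le, Real.rpow_neg hr.le]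
  simp_rw [key]
  rw [lintegral_lintegral_swap (by fun_prop)]
  have inner : ∀ s ∈ Set.Ioi (0 : ℝ),
      ∫⁻ t : ℝ, ENNReal.ofReal (s ^ ((ν + 1) / 2 - 1) * Real.exp (-((1 + t ^ 2 / ν) * s))) =
      ENNReal.ofReal √(ν * Real.pi) *
        ENNReal.ofReal (s ^ (ν / 2 - 1) * Real.exp (-(1 * s))) := by
    intro s hs
    have hs : 0 < s := hs
    have h1 : ∀ t : ℝ, s ^ ((ν + 1) / 2 - 1) * Real.exp (-((1 + t ^ 2 / ν) * s)) =
        s ^ ((ν + 1) / 2 - 1) * Real.exp (-s) * Real.exp (-(s / ν) * t ^ 2) := by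
      intro t
      rw [mul_assoc, ← Real.exp_add]
      congr 2
      ring
    have h2 : 0 ≤ s ^ ((ν + 1) / 2 - 1) * Real.exp (-s) := by positivity
    simp_rw [h1, ENNReal.ofReal_mul h2]
    rw [lintegral_const_mul _ (by fun_prop), lintegral_exp_neg_mul_sq (by positivity),
      ← ENNReal.ofReal_mul h2, ← ENNReal.ofReal_mul (by positivity)]
    congr 1
    have h3 : Real.pi / (s / ν) = ν * Real.pi * s⁻¹ := by field_simp
    have h4 : s ^ ((ν + 1) / 2 - 1) = s ^ (ν / 2 - 1) * √s := by
      rw [Real.sqrt_eq_rpow, ← Real.rpow_add hs]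
      congr 1
      ring
    rw [h3, Real.sqrt_mul (by positivity), Real.sqrt_inv, h4, one_mul]
    have h5 : √s ≠ 0 := (Real.sqrt_pos.2 hs).ne'
    field_simp
  rw [setLIntegral_congr_fun measurableSet_Ioi inner, lintegral_const_mul _ (by fun_prop),
    lintegral_rpow_mul_exp_neg_mul_Ioi (by positivity) one_pos, ← ENNReal.ofReal_mul (by positivity)]
  simp

theorem studentTPDF_pos {ν : ℝ} (hν : 0 < ν) (t : ℝ) : 0 < studentTPDF ν t := by
  have h1 := Real.Gamma_pos_of_pos (show 0 < (ν + 1) / 2 by positivity)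
  have h2 := Real.Gamma_pos_of_pos (show 0 < ν / 2 by positivity)
  have := Real.pi_pos
  unfold studentTPDF
  positivity

theorem studentTPDF_neg (ν t : ℝ) : studentTPDF ν (-t) = studentTPDF ν t := by
  simp [studentTPDF]

theorem continuous_studentTPDF {ν : ℝ} (hν : 0 < ν) : Continuous (studentTPDF ν) := by
  unfold studentTPDF
  refine continuous_const.mul (Continuous.rpow_const (by fun_prop) fun t => Or.inl ?_)
  positivity

theorem lintegral_studentTPDF {ν : ℝ} (hν : 0 < ν) :
    ∫⁻ t, ENNReal.ofReal (studentTPDF ν t) = 1 := by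
  have h2 := Real.Gamma_pos_of_pos (show 0 < ν / 2 by positivity)
  have hπ := Real.pi_pos
  have h3 : 0 < √(ν * Real.pi) * Real.Gamma (ν / 2) := by positivity
  have h : ∀ t, ENNReal.ofReal (studentTPDF ν t) =
      ENNReal.ofReal (√(ν * Real.pi) * Real.Gamma (ν / 2))⁻¹ *
        ENNReal.ofReal ((1 + t ^ 2 / ν) ^ (-((ν + 1) / 2)) * Real.Gamma ((ν + 1) / 2)) := by
    intro t
    rw [← ENNReal.ofReal_mul (by positivity)]
    congr 1
    unfold studentTPDF
    field_simp
  simp_rw [h]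
  have hm : Measurable fun t : ℝ => (1 + t ^ 2 / ν) ^ (-((ν + 1) / 2)) := by fun_prop
  rw [lintegral_const_mul _ (by fun_prop), lintegral_one_add_sq_div_rpow hν,
    ← ENNReal.ofReal_mul (by positivity), inv_mul_cancel₀ h3.ne', ENNReal.ofReal_one]

/-- The density of `𝒯(ν)` for `ν ∈ (0, ∞]`, the standard normal density at `ν = ∞`. -/
noncomputable def tDensity (ν : ℝ≥0∞) : ℝ → ℝ :=
  if ν = ∞ then gaussianPDFReal 0 1 else studentTPDF ν.toReal

theorem studentT_eq_withDensity (ν : ℝ≥0∞) :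
    studentT ν = volume.withDensity fun t => ENNReal.ofReal (tDensity ν t) := by
  unfold studentT tDensity
  split_ifs with h
  · rw [gaussianReal_of_var_ne_zero 0 one_ne_zero]
    rfl
  · rfl

theorem tDensity_pos {ν : ℝ≥0∞} (hν : 0 < ν) (t : ℝ) : 0 < tDensity ν t := by
  unfold tDensity
  split_ifs with h
  · exact gaussianPDFReal_pos _ _ _ one_ne_zero
  · exact studentTPDF_pos (ENNReal.toReal_pos hν.ne' h) t

theorem tDensity_neg (ν : ℝ≥0∞) (t : ℝ) : tDensity ν (-t) = tDensity ν t := by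
  unfold tDensity
  split_ifs with h
  · simp [gaussianPDFReal]
  · exact studentTPDF_neg _ t

theorem continuous_tDensity {ν : ℝ≥0∞} (hν : 0 < ν) : Continuous (tDensity ν) := by
  unfold tDensity
  split_ifs with h
  · unfold gaussianPDFReal
    fun_prop
  · exact continuous_studentTPDF (ENNReal.toReal_pos hν.ne' h)

theorem isProbabilityMeasure_studentT {ν : ℝ≥0∞} (hν : 0 < ν) :
    IsProbabilityMeasure (studentT ν) := by
  unfold studentT
  split_ifs with h
  · infer_instance
  · refine ⟨?_⟩
    rw [withDensity_apply _ MeasurableSet.univ, setLIntegral_univ,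
      lintegral_studentTPDF (ENNReal.toReal_pos hν.ne' h)]

theorem nullSingletonClass_studentT (ν : ℝ≥0∞) : NullSingletonClass (studentT ν) := by
  rw [studentT_eq_withDensity]
  exact ⟨fun x => withDensity_absolutelyContinuous _ _ (measure_singleton x)⟩

/-- With `κ = 1 / ν`, which is `0` at `ν = ∞`, the logarithmic derivative of the density of `𝒯(ν)`
is `-(1 + κ) x / (1 + κ x²)` for all `ν ∈ (0, ∞]`. -/
theorem hasDerivAt_log_tDensity {ν : ℝ≥0∞} (hν : 0 < ν) (x : ℝ) :
    HasDerivAt (fun t => Real.log (tDensity ν t))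
      (-((1 + ν.toReal⁻¹) * x / (1 + ν.toReal⁻¹ * x ^ 2))) x := by
  unfold tDensity
  split_ifs with h
  · have h1 : (fun t => Real.log (gaussianPDFReal 0 1 t)) =
        fun t => Real.log (√(2 * Real.pi))⁻¹ + -t ^ 2 / 2 := by
      funext t
      have h2 : (√(2 * Real.pi))⁻¹ ≠ 0 := by positivity
      simp only [gaussianPDFReal, NNReal.coe_one, mul_one, sub_zero]
      rw [Real.log_mul h2 (Real.exp_ne_zero _), Real.log_exp]
    rw [h1, h]
    refine (((((hasDerivAt_id x).pow 2).neg.div_const 2).const_add _).congr_deriv ?_)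
    simp
    ring
  · have hr : 0 < ν.toReal := ENNReal.toReal_pos hν.ne' h
    set r := ν.toReal
    have g1 := Real.Gamma_pos_of_pos (show 0 < (r + 1) / 2 by positivity)
    have g2 := Real.Gamma_pos_of_pos (show 0 < r / 2 by positivity)
    have hπ := Real.pi_pos
    have h1 : (fun t => Real.log (studentTPDF r t)) =
        fun t => Real.log (1 / √(r * Real.pi) * (Real.Gamma ((r + 1) / 2) / Real.Gamma (r / 2))) +
          -((r + 1) / 2) * Real.log (1 + t ^ 2 / r) := by
      funext t
      have h2 : 0 < 1 + t ^ 2 / r := by positivity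
      rw [studentTPDF, Real.log_mul (by positivity) (by positivity), Real.log_rpow h2]
    have h2 : 0 < 1 + x ^ 2 / r := by positivity
    have hd : HasDerivAt (fun t : ℝ => 1 + t ^ 2 / r) (2 * x / r) x := by
      simpa using (((hasDerivAt_id x).pow 2).div_const r).const_add 1
    rw [h1]
    refine ((((hd.log h2.ne').const_mul (-((r + 1) / 2))).const_add _).congr_deriv ?_)
    field_simp

/-! ### Star order of Student's t distributions -/

/-- After the rescaling by `a`, the difference of the densities can change sign only from `+` to `-`
to `+`: once it has become positive after a negative value, it remains positive. -/
theorem tDensity_lt_of_crossing {ν₁ ν₂ : ℝ≥0∞} (h₁ : 0 < ν₁) (h₁₂ : ν₁ ≤ ν₂) {a x y z : ℝ}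
    (ha : 0 < a) (hx : 0 < x) (hxy : x < y) (hyz : y < z)
    (hfx : a * tDensity ν₁ (a * x) < tDensity ν₂ x)
    (hfy : tDensity ν₂ y < a * tDensity ν₁ (a * y)) :
    tDensity ν₂ z < a * tDensity ν₁ (a * z) := by
  have h₂ : 0 < ν₂ := h₁.trans_le h₁₂
  have pos₁ := tDensity_pos h₁
  have pos₂ := tDensity_pos h₂
  set k₁ := ν₁.toReal⁻¹ with hk₁
  set k₂ := ν₂.toReal⁻¹ with hk₂
  have hk₁0 : 0 ≤ k₁ := inv_nonneg.2 ENNReal.toReal_nonneg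
  have hk₂0 : 0 ≤ k₂ := inv_nonneg.2 ENNReal.toReal_nonneg
  have hk : k₂ ≤ k₁ := by
    by_cases htop : ν₂ = ∞
    · simpa [hk₂, htop] using hk₁0
    · have hne : ν₁ ≠ ∞ := ne_top_of_le_ne_top htop h₁₂
      exact inv_anti₀ (ENNReal.toReal_pos h₁.ne' hne) (ENNReal.toReal_mono htop h₁₂)
  -- `d t` is the logarithm of the ratio of the two densities, whose derivative has the sign of an
  -- increasing affine function of `t ^ 2`.
  set d : ℝ → ℝ := fun t => Real.log (tDensity ν₁ (a * t)) - Real.log (tDensity ν₂ t) with hd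
  set d' : ℝ → ℝ := fun t => t * ((1 + k₂) * (1 + k₁ * (a * t) ^ 2) -
      (1 + k₁) * a ^ 2 * (1 + k₂ * t ^ 2)) / ((1 + k₁ * (a * t) ^ 2) * (1 + k₂ * t ^ 2)) with hd'
  have hderiv : ∀ t, HasDerivAt d (d' t) t := by
    intro t
    have e₁ := (hasDerivAt_log_tDensity h₁ (a * t)).comp t ((hasDerivAt_id t).const_mul a)
    refine (e₁.sub (hasDerivAt_log_tDensity h₂ t)).congr_deriv ?_
    have p₁ : 1 + k₁ * (a * t) ^ 2 ≠ 0 := by positivity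
    have p₂ : 1 + k₂ * t ^ 2 ≠ 0 := by positivity
    rw [← hk₁, ← hk₂, hd']
    field_simp
    ring
  have hcont : ∀ s, ContinuousOn d s := fun s t _ => (hderiv t).continuousAt.continuousWithinAt
  have dlt : ∀ t, a * tDensity ν₁ (a * t) < tDensity ν₂ t ↔ d t < -Real.log a := by
    intro t
    rw [← Real.log_lt_log_iff (mul_pos ha (pos₁ _)) (pos₂ _), Real.log_mul ha.ne' (pos₁ _).ne', hd]
    constructor <;> intro h <;> linarith
  have ltd : ∀ t, tDensity ν₂ t < a * tDensity ν₁ (a * t) ↔ -Real.log a < d t := by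
    intro t
    rw [← Real.log_lt_log_iff (pos₂ _) (mul_pos ha (pos₁ _)), Real.log_mul ha.ne' (pos₁ _).ne', hd]
    constructor <;> intro h <;> linarith
  rw [dlt] at hfx
  rw [ltd] at hfy ⊢
  by_contra! hz
  obtain ⟨s, ⟨hs1, hs2⟩, hs⟩ :=
    exists_hasDerivAt_eq_slope d d' hxy (hcont _) fun t _ => hderiv t
  obtain ⟨t, ⟨ht1, ht2⟩, ht⟩ :=
    exists_hasDerivAt_eq_slope d d' hyz (hcont _) fun t _ => hderiv t
  have hspos : 0 < d' s := by
    rw [hs]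
    exact div_pos (by linarith) (by linarith)
  have htneg : d' t < 0 := by
    rw [ht]
    exact div_neg_of_neg_of_pos (by linarith) (by linarith)
  have s0 : 0 < s := hx.trans hs1
  have t0 : 0 < t := by linarith
  have hs' : 0 < (1 + k₂) * (1 + k₁ * (a * s) ^ 2) - (1 + k₁) * a ^ 2 * (1 + k₂ * s ^ 2) := by
    by_contra! hle
    exact hspos.not_ge (div_nonpos_of_nonpos_of_nonneg
      (mul_nonpos_of_nonneg_of_nonpos s0.le hle) (by positivity))
  have ht' : (1 + k₂) * (1 + k₁ * (a * t) ^ 2) - (1 + k₁) * a ^ 2 * (1 + k₂ * t ^ 2) < 0 := by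
    by_contra! hle
    exact htneg.not_ge (div_nonneg (mul_nonneg t0.le hle) (by positivity))
  have hst : s ^ 2 ≤ t ^ 2 := by gcongr; linarith
  have := mul_nonneg (mul_nonneg (sq_nonneg a) (sub_nonneg.2 hk)) (sub_nonneg.2 hst)
  nlinarith

/-- The probability that `|X| ≤ x` when `X` has law `𝒯(ν)`, for `x ≥ 0`. -/
noncomputable def absCDF (ν : ℝ≥0∞) (x : ℝ) : ℝ :=
  ∫ t in (-x)..x, tDensity ν t

theorem absCDF_zero (ν : ℝ≥0∞) : absCDF ν 0 = 0 := by
  simp [absCDF]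

theorem hasDerivAt_absCDF {ν : ℝ≥0∞} (hν : 0 < ν) (x : ℝ) :
    HasDerivAt (absCDF ν) (2 * tDensity ν x) x := by
  have hc := continuous_tDensity hν
  have hint : ∀ a b, IntervalIntegrable (tDensity ν) volume a b :=
    fun a b => hc.intervalIntegrable a b
  have h : absCDF ν =
      fun x => (∫ t in (0 : ℝ)..x, tDensity ν t) - ∫ t in (0 : ℝ)..(-x), tDensity ν t := by
    funext x
    rw [absCDF, intervalIntegral.integral_interval_sub_left (hint _ _) (hint _ _)]
  have hd : ∀ y, HasDerivAt (fun u => ∫ t in (0 : ℝ)..u, tDensity ν t) (tDensity ν y) y :=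
    fun y => hc.integral_hasStrictDerivAt 0 y |>.hasDerivAt
  rw [h]
  refine ((hd x).sub ((hd (-x)).comp x (hasDerivAt_neg x))).congr_deriv ?_
  rw [tDensity_neg]
  ring

theorem continuous_absCDF {ν : ℝ≥0∞} (hν : 0 < ν) : Continuous (absCDF ν) :=
  continuous_iff_continuousAt.2 fun x => (hasDerivAt_absCDF hν x).continuousAt

theorem strictMono_absCDF {ν : ℝ≥0∞} (hν : 0 < ν) : StrictMono (absCDF ν) :=
  strictMono_of_hasDerivAt_pos (hasDerivAt_absCDF hν)
    fun x => mul_pos two_pos (tDensity_pos hν x)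

theorem studentT_abs_le {ν : ℝ≥0∞} (hν : 0 < ν) {x : ℝ} (hx : 0 ≤ x) :
    studentT ν {t | |t| ≤ x} = ENNReal.ofReal (absCDF ν x) := by
  have hset : {t : ℝ | |t| ≤ x} = Set.Icc (-x) x := by
    ext t
    simp [abs_le]
  rw [hset, studentT_eq_withDensity, withDensity_apply _ measurableSet_Icc, absCDF,
    intervalIntegral.integral_of_le (by linarith), ← integral_Icc_eq_integral_Ioc,
    ofReal_integral_eq_lintegral_ofReal]
  · exact (continuous_tDensity hν).integrableOn_Icc
  · exact ae_of_all _ fun t => (tDensity_pos hν t).le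

theorem integrable_tDensity {ν : ℝ≥0∞} (hν : 0 < ν) : Integrable (tDensity ν) := by
  have := isProbabilityMeasure_studentT hν
  refine (lintegral_ofReal_ne_top_iff_integrable
    (continuous_tDensity hν).aestronglyMeasurable
    (ae_of_all _ fun t => (tDensity_pos hν t).le)).1 ?_
  rw [← setLIntegral_univ, ← withDensity_apply _ MeasurableSet.univ, ← studentT_eq_withDensity]
  exact measure_ne_top _ _

theorem tendsto_absCDF {ν : ℝ≥0∞} (hν : 0 < ν) :
    Filter.Tendsto (absCDF ν) Filter.atTop (nhds 1) := by
  have := isProbabilityMeasure_studentT hν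
  have h1 : ∫ t, tDensity ν t = 1 := by
    rw [integral_eq_lintegral_of_nonneg_ae (ae_of_all _ fun t => (tDensity_pos hν t).le)
      (continuous_tDensity hν).aestronglyMeasurable, ← setLIntegral_univ,
      ← withDensity_apply _ MeasurableSet.univ, ← studentT_eq_withDensity]
    simp
  rw [← h1]
  exact intervalIntegral_tendsto_integral (integrable_tDensity hν)
    Filter.tendsto_neg_atTop_atBot Filter.tendsto_id

theorem exists_absCDF_eq {ν ν' : ℝ≥0∞} (hν : 0 < ν) (hν' : 0 < ν') {x : ℝ} (hx : 0 ≤ x) :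
    ∃ p, 0 ≤ p ∧ absCDF ν p = absCDF ν' x := by
  have hlt : absCDF ν' x < 1 :=
    (strictMono_absCDF hν' (lt_add_one x)).trans_le
      ((strictMono_absCDF hν').monotone.ge_of_tendsto (tendsto_absCDF hν') _)
  obtain ⟨b, hb, hb0⟩ :=
    (((tendsto_absCDF hν).eventually_const_lt hlt).and (Filter.eventually_ge_atTop 0)).exists
  have h0 : absCDF ν 0 ≤ absCDF ν' x := by
    rw [absCDF_zero, ← absCDF_zero ν']
    exact (strictMono_absCDF hν').monotone hx
  obtain ⟨p, hp, hpx⟩ :=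
    intermediate_value_Icc hb0 (continuous_absCDF hν).continuousOn ⟨h0, hb.le⟩
  exact ⟨p, hp.1, hpx⟩

/-- If `p` and `q` are the quantiles of `|X₁|` that correspond to the quantiles `x < y` of `|X₂|`,
then `p / x ≤ q / y`. Otherwise the difference `D` of the distribution functions of `|X₁| / a` and
`|X₂|`, where `a = q / y`, is negative at `x` and zero at `0` and `y`; by the sign pattern of the
densities it is strictly increasing after `y`, whereas it tends to `0` at infinity. -/
theorem absCDF_star_order {ν₁ ν₂ : ℝ≥0∞} (h₁ : 0 < ν₁) (h₁₂ : ν₁ ≤ ν₂) {x y p q : ℝ}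
    (hx : 0 < x) (hxy : x < y) (hp : absCDF ν₁ p = absCDF ν₂ x) (hq : absCDF ν₁ q = absCDF ν₂ y) :
    p * y ≤ q * x := by
  have h₂ : 0 < ν₂ := h₁.trans_le h₁₂
  have hy : 0 < y := hx.trans hxy
  have hq0 : 0 < q := by
    rw [← (strictMono_absCDF h₁).lt_iff_lt, hq, absCDF_zero, ← absCDF_zero ν₂]
    exact strictMono_absCDF h₂ hy
  by_contra! hlt
  set a := q / y with ha
  have ha0 : 0 < a := div_pos hq0 hy
  set D : ℝ → ℝ := fun t => absCDF ν₁ (a * t) - absCDF ν₂ t with hD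
  set D' : ℝ → ℝ := fun t => 2 * (a * tDensity ν₁ (a * t) - tDensity ν₂ t) with hD'
  have hderiv : ∀ t, HasDerivAt D (D' t) t := by
    intro t
    have e₁ := (hasDerivAt_absCDF h₁ (a * t)).comp t ((hasDerivAt_id t).const_mul a)
    refine (e₁.sub (hasDerivAt_absCDF h₂ t)).congr_deriv ?_
    rw [hD']
    ring
  have hcont : ∀ s, ContinuousOn D s := fun s t _ => (hderiv t).continuousAt.continuousWithinAt
  have D0 : D 0 = 0 := by simp [hD, absCDF_zero]
  have Dy : D y = 0 := by
    rw [hD]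
    simp only [ha, div_mul_cancel₀ _ hy.ne', hq, sub_self]
  have Dx : D x < 0 := by
    have : a * x < p := by
      rw [ha, div_mul_eq_mul_div, div_lt_iff₀ hy]
      exact hlt
    have := strictMono_absCDF h₁ this
    rw [hp] at this
    exact sub_neg.2 this
  have Dlim : Filter.Tendsto D Filter.atTop (nhds 0) := by
    have := ((tendsto_absCDF h₁).comp (Filter.tendsto_id.const_mul_atTop ha0)).sub
      (tendsto_absCDF h₂)
    simpa using this
  obtain ⟨s, ⟨hs1, hs2⟩, hs⟩ :=
    exists_hasDerivAt_eq_slope D D' hx (hcont _) fun t _ => hderiv t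
  obtain ⟨t, ⟨ht1, ht2⟩, ht⟩ :=
    exists_hasDerivAt_eq_slope D D' hxy (hcont _) fun t _ => hderiv t
  have hsneg : D' s < 0 := by
    rw [hs]
    exact div_neg_of_neg_of_pos (by linarith) (by linarith)
  have htpos : 0 < D' t := by
    rw [ht]
    exact div_pos (by linarith) (by linarith)
  have hmono : StrictMonoOn D (Set.Ici y) := by
    refine strictMonoOn_of_hasDerivWithinAt_pos (convex_Ici y) (hcont _)
      (fun u _ => (hderiv u).hasDerivWithinAt) fun u hu => ?_
    rw [interior_Ici] at hu
    have := tDensity_lt_of_crossing h₁ h₁₂ ha0 hs1 (hs2.trans ht1) (ht2.trans hu)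
      (by simp only [hD'] at hsneg; linarith) (by simp only [hD'] at htpos; linarith)
    simp only [hD']
    linarith
  have hpos : 0 < D (y + 1) := by
    rw [← Dy]
    exact hmono Set.self_mem_Ici (by simp) (lt_add_one y)
  refine hpos.not_ge (ge_of_tendsto Dlim ?_)
  filter_upwards [Filter.eventually_ge_atTop (y + 1)] with u hu
  exact hmono.monotoneOn (by simp) (by simp only [Set.mem_Ici]; linarith) hu

/-- For `ν₁ ≤ ν₂` the law of `|X₁|` is the image of the law of `X₂` under a transport map `φ` such
that `φ x / |x|` is a nondecreasing function of `|x|`; this is the star order of `|X₂|` and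
`|X₁|`. -/
theorem exists_star_transport {ν₁ ν₂ : ℝ≥0∞} (h₁ : 0 < ν₁) (h₁₂ : ν₁ ≤ ν₂) :
    ∃ φ : ℝ → ℝ, Measurable φ ∧ (∀ x, 0 ≤ φ x) ∧ (∀ x, x ≠ 0 → 0 < φ x) ∧
      (∀ x y, |x| ≤ |y| → φ x * |y| ≤ φ y * |x|) ∧
      (studentT ν₂).map φ = (studentT ν₁).map (fun x => |x|) := by
  have h₂ : 0 < ν₂ := h₁.trans_le h₁₂
  have := isProbabilityMeasure_studentT h₁
  have := isProbabilityMeasure_studentT h₂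
  choose φ hφ0 hφ using fun x : ℝ => exists_absCDF_eq h₁ h₂ (abs_nonneg x)
  have hpre : ∀ t, 0 ≤ t → ∃ s, 0 ≤ s ∧ absCDF ν₂ s = absCDF ν₁ t ∧
      φ ⁻¹' Set.Iic t = {x | |x| ≤ s} := by
    intro t ht
    obtain ⟨s, hs0, hs⟩ := exists_absCDF_eq h₂ h₁ ht
    refine ⟨s, hs0, hs, ?_⟩
    ext x
    rw [Set.mem_preimage, Set.mem_Iic, Set.mem_ofPred_eq, ← (strictMono_absCDF h₁).le_iff_le, hφ,
      ← hs, (strictMono_absCDF h₂).le_iff_le]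
  have hpre_neg : ∀ t < 0, φ ⁻¹' Set.Iic t = ∅ := by
    intro t ht
    ext x
    simpa using ht.trans_le (hφ0 x)
  have hmeas : Measurable φ := by
    refine measurable_of_Iic fun t => ?_
    rcases lt_or_ge t 0 with ht | ht
    · rw [hpre_neg t ht]
      exact MeasurableSet.empty
    · obtain ⟨s, -, -, hs⟩ := hpre t ht
      rw [hs]
      exact measurableSet_le (by fun_prop) measurable_const
  have hpos : ∀ x, x ≠ 0 → 0 < φ x := by
    intro x hx
    rw [← (strictMono_absCDF h₁).lt_iff_lt, hφ, absCDF_zero, ← absCDF_zero ν₂]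
    exact strictMono_absCDF h₂ (abs_pos.2 hx)
  refine ⟨φ, hmeas, hφ0, hpos, fun x y hxy => ?_, ?_⟩
  · rcases hxy.eq_or_lt with h | h
    · have : φ x = φ y := (strictMono_absCDF h₁).injective (by rw [hφ, hφ, h])
      rw [this, h]
    · rcases (abs_nonneg x).eq_or_lt with hx | hx
      · have : φ x = 0 :=
          (strictMono_absCDF h₁).injective (by rw [hφ, ← hx, absCDF_zero, absCDF_zero])
        rw [this, ← hx]
        simp
      · exact absCDF_star_order h₁ h₁₂ hx h (hφ x) (hφ y)
  · have := Measure.isProbabilityMeasure_map (μ := studentT ν₂) hmeas.aemeasurable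
    refine Measure.ext_of_Iic _ _ fun t => ?_
    rw [Measure.map_apply hmeas measurableSet_Iic,
      Measure.map_apply (by fun_prop) measurableSet_Iic]
    rcases lt_or_ge t 0 with ht | ht
    · have : (fun x : ℝ => |x|) ⁻¹' Set.Iic t = ∅ := by
        ext x
        simpa using ht.trans_le (abs_nonneg x)
      rw [hpre_neg t ht, this, measure_empty, measure_empty]
    · obtain ⟨s, hs0, hs, hset⟩ := hpre t ht
      rw [hset, studentT_abs_le h₂ hs0, hs, ← studentT_abs_le h₁ ht]
      rfl

/-! ### The modified Greenwood statistic -/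

theorem measurable_greenwoodStat {n : ℕ} : Measurable (greenwoodStat (n := n)) := by
  unfold greenwoodStat
  fun_prop

/-- If `bᵢ / aᵢ` is a nondecreasing function of `aᵢ`, then the normalized vector `b / ∑ bᵢ` has a
larger sum of squares than `a / ∑ aᵢ`. The inequality follows from the Chebyshev sum inequality
`(∑ aᵢ²) (∑ bᵢ) ≤ (∑ aᵢ bᵢ) (∑ aᵢ)`, with weights `aᵢ`, and the Cauchy-Schwarz inequality. -/
theorem sum_sq_div_sq_sum_le_of_star {ι : Type*} [Fintype ι] {a b : ι → ℝ}
    (ha : 0 < ∑ i, a i) (hb : 0 < ∑ i, b i)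
    (h : ∀ i j, a i ≤ a j → b i * a j ≤ b j * a i) :
    (∑ i, a i ^ 2) / (∑ i, a i) ^ 2 ≤ (∑ i, b i ^ 2) / (∑ i, b i) ^ 2 := by
  have hcheb : (∑ i, a i ^ 2) * ∑ i, b i ≤ (∑ i, a i * b i) * ∑ i, a i := by
    have h0 : 0 ≤ ∑ i, ∑ j, (a i - a j) * (b i * a j - b j * a i) := by
      refine Finset.sum_nonneg fun i _ => Finset.sum_nonneg fun j _ => ?_
      rcases le_total (a i) (a j) with hij | hij
      · exact mul_nonneg_of_nonpos_of_nonpos (sub_nonpos.2 hij) (sub_nonpos.2 (h i j hij))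
      · exact mul_nonneg (sub_nonneg.2 hij) (sub_nonneg.2 (h j i hij))
    have h1 : ∑ i, ∑ j, (a i - a j) * (b i * a j - b j * a i) =
        2 * ((∑ i, a i * b i) * ∑ i, a i) - 2 * ((∑ i, a i ^ 2) * ∑ i, b i) := by
      have h2 : ∀ i j, (a i - a j) * (b i * a j - b j * a i) =
          (a i * b i) * a j + a i * (a j * b j) - (a i ^ 2 * b j + b i * a j ^ 2) := by
        intro i j
        ring
      simp_rw [h2, Finset.sum_sub_distrib, Finset.sum_add_distrib, ← Finset.mul_sum,
        ← Finset.sum_mul]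
      ring
    linarith
  have hcs : (∑ i, a i * b i) ^ 2 ≤ (∑ i, a i ^ 2) * ∑ i, b i ^ 2 :=
    Finset.sum_mul_sq_le_sq_mul_sq _ _ _
  have hsq : (∑ i, a i) ^ 2 ≤ (Fintype.card ι : ℝ) * ∑ i, a i ^ 2 := sq_sum_le_card_mul_sum_sq
  have hP : 0 < ∑ i, a i ^ 2 :=
    pos_of_mul_pos_right ((pow_pos ha 2).trans_le hsq) (Nat.cast_nonneg _)
  rw [div_le_div_iff₀ (pow_pos ha 2) (pow_pos hb 2)]
  refine le_of_mul_le_mul_left ?_ hP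
  calc (∑ i, a i ^ 2) * ((∑ i, a i ^ 2) * (∑ i, b i) ^ 2)
      = ((∑ i, a i ^ 2) * ∑ i, b i) ^ 2 := by ring
    _ ≤ ((∑ i, a i * b i) * ∑ i, a i) ^ 2 := by gcongr
    _ = (∑ i, a i * b i) ^ 2 * (∑ i, a i) ^ 2 := by ring
    _ ≤ ((∑ i, a i ^ 2) * ∑ i, b i ^ 2) * (∑ i, a i) ^ 2 := by gcongr
    _ = (∑ i, a i ^ 2) * ((∑ i, b i ^ 2) * (∑ i, a i) ^ 2) := by ring

theorem one_div_le_greenwoodStat {n : ℕ} {x : Fin n → ℝ} (hx : 0 < ∑ i, |x i|) :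
    1 / (n : ℝ) ≤ greenwoodStat x := by
  have h : (∑ i, |x i|) ^ 2 ≤ (n : ℝ) * ∑ i, |x i| ^ 2 := by
    simpa using sq_sum_le_card_mul_sum_sq (s := Finset.univ) (f := fun i => |x i|)
  have hn : (0 : ℝ) < n :=
    pos_of_mul_pos_left ((pow_pos hx 2).trans_le h) (by positivity)
  rw [greenwoodStat, div_le_div_iff₀ hn (pow_pos hx 2)]
  linarith

theorem measurableSet_rejectionRegionMG4 (n : ℕ) (c : ℝ) :
    MeasurableSet (rejectionRegionMG4 n c) :=
  measurable_greenwoodStat measurableSet_Icc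

/-- The statistic has a continuous distribution: when the other coordinates are fixed and not all
zero, `S_n = q` is a nontrivial polynomial equation for the absolute value of the first one. -/
theorem pi_greenwoodStat_eq_null {n : ℕ} (hn : 2 ≤ n) (μ : Measure ℝ) [SigmaFinite μ]
    [NullSingletonClass μ] (q : ℝ) :
    Measure.pi (fun _ : Fin n => μ) {x | greenwoodStat x = q} = 0 := by
  obtain ⟨m, rfl⟩ := Nat.exists_eq_add_of_le' hn
  have hE : MeasurableSet {x : Fin (m + 2) → ℝ | greenwoodStat x = q} :=
    measurable_greenwoodStat (measurableSet_singleton q)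
  have hmp := (measurePreserving_piFinSuccAbove (fun _ : Fin (m + 1 + 1) => μ) 0).symm
  rw [← hmp.measure_preimage hE.nullMeasurableSet,
    Measure.prod_apply_symm (MeasurableEquiv.measurable _ hE)]
  refine lintegral_eq_zero_of_ae_eq_zero ?_
  filter_upwards [Measure.ae_eval_ne (fun _ : Fin (m + 1) => μ) 0 0] with y hy
  set A := ∑ i, |y i| ^ 2 with hA
  set B := ∑ i, |y i| with hB
  have hBpos : 0 < B :=
    Finset.sum_pos' (fun i _ => abs_nonneg _) ⟨0, Finset.mem_univ _, abs_pos.2 hy⟩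
  set P : Polynomial ℝ :=
    .C (1 - q) * .X ^ 2 + .C (-(2 * q * B)) * .X + .C (A - q * B ^ 2) with hP
  have hP0 : P ≠ 0 := by
    intro h0
    have hev : ∀ t, (1 - q) * t ^ 2 + -(2 * q * B) * t + (A - q * B ^ 2) = 0 := by
      intro t
      rw [← Polynomial.eval_zero (x := t), ← h0]
      simp only [hP, Polynomial.eval_add, Polynomial.eval_mul, Polynomial.eval_C,
        Polynomial.eval_pow, Polynomial.eval_X]
    have hq : q = 1 := by linarith [hev 0, hev 1, hev (-1)]
    rw [hq] at hev
    linarith [hev 1, hev (-1)]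
  have hroots : {t | P.IsRoot t}.Finite := Polynomial.finite_setOfPred_isRoot hP0
  refine measure_mono_null ?_ ((hroots.union (hroots.image fun t => -t)).measure_zero μ)
  intro t ht
  have hS : (|t| ^ 2 + A) / (|t| + B) ^ 2 = q := by
    have ht' : greenwoodStat (Fin.cons t y : Fin (m + 2) → ℝ) = q := by
      rw [← Fin.insertNth_zero']
      exact ht
    rw [← ht', greenwoodStat, Fin.sum_univ_succ fun i => |(Fin.cons t y : Fin (m + 2) → ℝ) i|,
      Fin.sum_univ_succ]
    simp only [Fin.cons_zero, Fin.cons_succ, hA, hB]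
  rw [div_eq_iff (by positivity)] at hS
  have hroot : P.IsRoot |t| := by
    simp only [hP, Polynomial.IsRoot.def, Polynomial.eval_add, Polynomial.eval_mul,
      Polynomial.eval_C, Polynomial.eval_pow, Polynomial.eval_X]
    linear_combination hS
  rcases abs_choice t with h | h
  · exact Or.inl (h ▸ hroot)
  · exact Or.inr ⟨-t, h ▸ hroot, neg_neg t⟩

theorem ae_ne_zero_studentTSample (n : ℕ) {ν : ℝ≥0∞} (hν : 0 < ν) :
    ∀ᵐ x ∂(studentTSample n ν), ∀ i, x i ≠ 0 := by
  have := isProbabilityMeasure_studentT hν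
  have := nullSingletonClass_studentT ν
  exact ae_all_iff.2 fun i => Measure.ae_eval_ne _ i 0

/-! ### The power function -/

/-- The power function increases in `ν`: a sample of `|X₁|`'s is the image of a sample from `𝒯(ν₂)`
under the transport map of the star order, and that map increases the statistic. -/
theorem powerMG4_mono {n : ℕ} (hn : 0 < n) (c : ℝ) {ν₁ ν₂ : ℝ≥0∞} (h₁ : 0 < ν₁)
    (h₁₂ : ν₁ ≤ ν₂) : powerMG4 n c ν₁ ≤ powerMG4 n c ν₂ := by
  have h₂ : 0 < ν₂ := h₁.trans_le h₁₂
  have := isProbabilityMeasure_studentT h₁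
  have := isProbabilityMeasure_studentT h₂
  have : Nonempty (Fin n) := ⟨⟨0, hn⟩⟩
  obtain ⟨φ, hφm, hφ0, hφpos, hφstar, hφmap⟩ := exists_star_transport h₁ h₁₂
  have := Measure.isProbabilityMeasure_map (μ := studentT ν₂) hφm.aemeasurable
  have habs : Measurable fun x : ℝ => |x| := by fun_prop
  have := Measure.isProbabilityMeasure_map (μ := studentT ν₁) habs.aemeasurable
  have hR := measurableSet_rejectionRegionMG4 n c
  have e₁ : studentTSample n ν₁ (rejectionRegionMG4 n c) =
      Measure.pi (fun _ : Fin n => (studentT ν₁).map fun x => |x|) (rejectionRegionMG4 n c) := by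
    rw [← Measure.pi_map_pi fun _ => habs.aemeasurable, Measure.map_apply (by fun_prop) hR]
    congr 1
    ext x
    simp [rejectionRegionMG4, greenwoodStat]
  have e₂ : Measure.pi (fun _ : Fin n => (studentT ν₁).map fun x => |x|) (rejectionRegionMG4 n c) =
      studentTSample n ν₂ ((fun x i => φ (x i)) ⁻¹' rejectionRegionMG4 n c) := by
    rw [← hφmap, ← Measure.pi_map_pi fun _ => hφm.aemeasurable,
      Measure.map_apply (by fun_prop) hR]
    rfl
  have : IsProbabilityMeasure (studentTSample n ν₂) := by
    unfold studentTSample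
    infer_instance
  refine ENNReal.toReal_mono (measure_ne_top _ _) ?_
  rw [e₁, e₂]
  refine measure_mono_ae ?_
  filter_upwards [ae_ne_zero_studentTSample n h₂] with x hx hxR
  have hpos : 0 < ∑ i, |x i| :=
    Finset.sum_pos (fun i _ => abs_pos.2 (hx i)) Finset.univ_nonempty
  have hpos' : 0 < ∑ i, φ (x i) :=
    Finset.sum_pos (fun i _ => hφpos _ (hx i)) Finset.univ_nonempty
  refine ⟨one_div_le_greenwoodStat hpos, le_trans ?_ hxR.2⟩
  have := sum_sq_div_sq_sum_le_of_star hpos hpos' fun i j hij => hφstar (x i) (x j) hij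
  simpa only [greenwoodStat, abs_of_nonneg (hφ0 _)] using this

theorem measureReal_Iic_quantile (μ : Measure ℝ) [IsProbabilityMeasure μ] [NullSingletonClass μ]
    {c : ℝ} (hc0 : 0 < c) (hc1 : c < 1) : μ.real (Set.Iic (quantile μ c)) = c := by
  have hcont : Continuous (cdf μ) := by
    refine continuous_iff_continuousAt.2 fun x => ?_
    rw [(monotone_cdf μ).continuousAt_iff_leftLim_eq_rightLim, StieltjesFunction.rightLim_eq]
    have h := (cdf μ).measure_singleton x
    rw [measure_cdf, measure_singleton, eq_comm, ENNReal.ofReal_eq_zero] at h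
    exact le_antisymm ((monotone_cdf μ).leftLim_le le_rfl) (by linarith)
  have hset : quantile μ c = sInf {x | c ≤ cdf μ x} := by
    simp_rw [quantile, cdf_eq_real]
  obtain ⟨b, hb⟩ := ((tendsto_cdf_atTop μ).eventually_const_lt hc1).exists
  obtain ⟨l, hl⟩ := ((tendsto_cdf_atBot μ).eventually_lt_const hc0).exists
  have hbdd : BddBelow {x | c ≤ cdf μ x} := by
    refine ⟨l, fun x hx => ?_⟩
    by_contra! hlt
    exact absurd (hx.trans (monotone_cdf μ hlt.le)) (not_le.2 hl)
  rw [← cdf_eq_real, hset]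
  refine le_antisymm ?_
    ((isClosed_le continuous_const hcont).csInf_mem ⟨b, hb.le⟩ hbdd)
  have hlt : Set.Iio (sInf {x | c ≤ cdf μ x}) ⊆ {x | cdf μ x ≤ c} := by
    intro x hx
    by_contra h
    exact notMem_of_lt_csInf hx hbdd (show c ≤ cdf μ x from (not_le.1 h).le)
  refine closure_minimal hlt (isClosed_le hcont continuous_const) ?_
  rw [closure_Iio]
  exact Set.self_mem_Iic

theorem powerMG4_two {n : ℕ} (hn : 2 ≤ n) {c : ℝ} (hc0 : 0 < c) (hc1 : c < 1) :
    powerMG4 n c 2 = c := by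
  have h2 : (0 : ℝ≥0∞) < 2 := by norm_num
  have := isProbabilityMeasure_studentT h2
  have := nullSingletonClass_studentT 2
  have : IsProbabilityMeasure (studentTSample n 2) := by
    unfold studentTSample
    infer_instance
  have hm := measurable_greenwoodStat (n := n)
  have := Measure.isProbabilityMeasure_map (μ := studentTSample n 2) hm.aemeasurable
  have : NullSingletonClass ((studentTSample n 2).map greenwoodStat) := by
    refine ⟨fun q => ?_⟩
    rw [Measure.map_apply hm (measurableSet_singleton q)]
    exact pi_greenwoodStat_eq_null hn (studentT 2) q
  have : Nonempty (Fin n) := ⟨⟨0, by omega⟩⟩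
  have hq := measureReal_Iic_quantile ((studentTSample n 2).map greenwoodStat) hc0 hc1
  rw [map_measureReal_apply hm measurableSet_Iic] at hq
  refine Eq.trans ?_ hq
  refine measureReal_congr ?_
  filter_upwards [ae_ne_zero_studentTSample n h2] with x hx
  have hpos : 0 < ∑ i, |x i| :=
    Finset.sum_pos (fun i _ => abs_pos.2 (hx i)) Finset.univ_nonempty
  exact propext ⟨fun h => h.2, fun h => ⟨one_div_le_greenwoodStat hpos, h⟩⟩

/-! ### Second moments -/

theorem memLp_two_studentT_iff {ν : ℝ≥0∞} (hν : 0 < ν) (htop : ν ≠ ∞) :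
    MemLp id 2 (studentT ν) ↔ Integrable fun t => t ^ 2 * studentTPDF ν.toReal t := by
  have hr := ENNReal.toReal_pos hν.ne' htop
  have hm := (continuous_studentTPDF hr).measurable
  rw [memLp_two_iff_integrable_sq aestronglyMeasurable_id, studentT, if_neg htop,
    integrable_withDensity_iff (by fun_prop) (ae_of_all _ fun _ => ENNReal.ofReal_lt_top)]
  simp_rw [ENNReal.toReal_ofReal (studentTPDF_pos hr _).le, id]

theorem not_memLp_two_studentT {ν : ℝ≥0∞} (hν : ν ∈ nullHyp) : ¬ MemLp id 2 (studentT ν) := by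
  have htop : ν ≠ ∞ := ne_top_of_le_ne_top (by norm_num) hν.2
  rw [memLp_two_studentT_iff hν.1 htop]
  have hr := ENNReal.toReal_pos hν.1.ne' htop
  have hr2 : ν.toReal ≤ 2 := by simpa using ENNReal.toReal_mono (by norm_num) hν.2
  set r := ν.toReal
  intro hint
  have hK : 0 < studentTPDF r 0 := studentTPDF_pos hr 0
  have hK' : ∀ t, studentTPDF r t = studentTPDF r 0 * (1 + t ^ 2 / r) ^ (-((r + 1) / 2)) := by
    intro t
    simp [studentTPDF]
  set C := studentTPDF r 0 * (1 + 1 / r) ^ (-((r + 1) / 2)) with hC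
  have hCpos : 0 < C := by positivity
  have hbad : IntegrableOn (fun t : ℝ => t ^ (-1 : ℝ)) (Set.Ioi 1) := by
    refine Integrable.mono' (hint.const_mul C⁻¹).integrableOn
      (by fun_prop) ?_
    filter_upwards [ae_restrict_mem measurableSet_Ioi] with t ht
    have ht1 : 1 < t := ht
    have ht0 : 0 < t := by linarith
    rw [Real.norm_of_nonneg (by positivity), inv_mul_eq_div, le_div_iff₀ hCpos, hK']
    -- for `t > 1` the density is at least `C * t ^ (-(r + 1))`
    have h1 : t ^ (-(r + 1)) * (1 + 1 / r) ^ (-((r + 1) / 2)) ≤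
        (1 + t ^ 2 / r) ^ (-((r + 1) / 2)) := by
      have e : t ^ (-(r + 1)) = (t ^ 2) ^ (-((r + 1) / 2)) := by
        rw [← Real.rpow_natCast, ← Real.rpow_mul ht0.le]
        congr 1
        push_cast
        ring
      rw [e, ← Real.mul_rpow (by positivity) (by positivity)]
      refine Real.rpow_le_rpow_of_nonpos (by positivity) ?_ (by linarith)
      have : 1 ≤ t ^ 2 := by nlinarith
      calc 1 + t ^ 2 / r ≤ t ^ 2 + t ^ 2 / r := by linarith
        _ = t ^ 2 * (1 + 1 / r) := by ring
    have h2 : t ^ (-1 : ℝ) ≤ t ^ 2 * t ^ (-(r + 1)) := by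
      rw [← Real.rpow_natCast, ← Real.rpow_add ht0]
      exact Real.rpow_le_rpow_of_exponent_le ht1.le (by push_cast; linarith)
    calc t ^ (-1 : ℝ) * C ≤ t ^ 2 * t ^ (-(r + 1)) * C := by gcongr
      _ = t ^ 2 * (studentTPDF r 0 * (t ^ (-(r + 1)) * (1 + 1 / r) ^ (-((r + 1) / 2)))) := by
        rw [hC]
        ring
      _ ≤ _ := by gcongr
  rw [integrableOn_Ioi_rpow_iff one_pos] at hbad
  exact lt_irrefl _ hbad

theorem memLp_two_studentT {ν : ℝ≥0∞} (hν : ν ∈ altHyp) : MemLp id 2 (studentT ν) := by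
  have hν2 : 2 < ν := hν
  have hν0 : 0 < ν := lt_trans (by norm_num) hν2
  by_cases htop : ν = ∞
  · rw [studentT, if_pos htop]
    exact memLp_id_gaussianReal' 2 (by norm_num)
  rw [memLp_two_studentT_iff hν0 htop]
  have hr := ENNReal.toReal_pos hν0.ne' htop
  have hr2 : 2 < ν.toReal := by simpa using ENNReal.toReal_strict_mono htop hν2
  set r := ν.toReal
  have hK : 0 < studentTPDF r 0 := studentTPDF_pos hr 0
  have hK' : ∀ t, studentTPDF r t = studentTPDF r 0 * (1 + t ^ 2 / r) ^ (-((r + 1) / 2)) := by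
    intro t
    simp [studentTPDF]
  have hint : Integrable (fun t : ℝ => (1 + ‖t‖ ^ 2) ^ (-(r - 1) / 2)) :=
    integrable_rpow_neg_one_add_norm_sq (by simp; linarith)
  have hcont := continuous_studentTPDF hr
  refine Integrable.mono' (hint.const_mul (studentTPDF r 0 * (1 / r) ^ (-((r + 1) / 2))))
    (by fun_prop) (ae_of_all _ fun t => ?_)
  have hpos := studentTPDF_pos hr t
  rw [Real.norm_of_nonneg (by positivity), hK', Real.norm_eq_abs, sq_abs]
  have hs : (1 + t ^ 2) ^ (-(r - 1) / 2) = (1 + t ^ 2) * (1 + t ^ 2) ^ (-((r + 1) / 2)) := by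
    rw [← Real.rpow_one_add' (by positivity) (by linarith)]
    congr 1
    ring
  have h1 : (1 + t ^ 2 / r) ^ (-((r + 1) / 2)) ≤
      (1 / r) ^ (-((r + 1) / 2)) * (1 + t ^ 2) ^ (-((r + 1) / 2)) := by
    rw [← Real.mul_rpow (by positivity) (by positivity)]
    refine Real.rpow_le_rpow_of_nonpos (by positivity) ?_ (by linarith)
    have : 1 / r ≤ 1 := by
      rw [div_le_one hr]
      linarith
    calc 1 / r * (1 + t ^ 2) = 1 / r + t ^ 2 / r := by ring
      _ ≤ 1 + t ^ 2 / r := by linarith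
  calc t ^ 2 * (studentTPDF r 0 * (1 + t ^ 2 / r) ^ (-((r + 1) / 2)))
      ≤ (1 + t ^ 2) * (studentTPDF r 0 *
        ((1 / r) ^ (-((r + 1) / 2)) * (1 + t ^ 2) ^ (-((r + 1) / 2)))) := by
        gcongr
        linarith
    _ = _ := by
        rw [hs]
        ring

theorem proposition6 (n : ℕ) (hn : 2 ≤ n) (c : ℝ) (hc0 : 0 < c) (hc1 : c < 1) :
    (∀ ν ∈ nullHyp, ¬ MemLp id 2 (studentT ν)) ∧
    (∀ ν ∈ altHyp, MemLp id 2 (studentT ν)) ∧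
    HasSize (powerMG4 n c) nullHyp c ∧
    IsUnbiasedTest (powerMG4 n c) nullHyp altHyp c ∧
    MonotoneOn (powerMG4 n c) (Set.Ioi 0) := by
  have h2 := powerMG4_two hn hc0 hc1
  have two_pos' : (0 : ℝ≥0∞) < 2 := by norm_num
  have hn0 : 0 < n := by omega
  have hnull : ∀ ν ∈ nullHyp, powerMG4 n c ν ≤ c := fun ν hν =>
    (powerMG4_mono hn0 c hν.1 hν.2).trans_eq h2
  refine ⟨fun ν hν => not_memLp_two_studentT hν, fun ν hν => memLp_two_studentT hν, ⟨?_, ?_⟩,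
    ⟨hnull, fun ν hν => ?_⟩, fun ν₁ h₁ ν₂ _ h => powerMG4_mono hn0 c h₁ h⟩
  · rintro _ ⟨ν, hν, rfl⟩
    exact hnull ν hν
  · exact fun b hb => h2 ▸ hb ⟨2, ⟨two_pos', le_rfl⟩, rfl⟩
  · exact h2.symm.trans_le (powerMG4_mono hn0 c two_pos' (le_of_lt hν))
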